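/- Let $(\Omega,\mathcal F,(\mathcal F_t)_{t\ge 0},\mathsf P)$ be a filtered probability space whose filtration is right-continuous, and let $M=(M_t)_{t\ge 0}$ be a real-valued local martingale, i.e. an adapted càdlàg process for which there exists a non-decreasing sequence $(T_n)_{n\in\mathbb N}$ of stopping times with $T_n\to\infty$ almost surely, such that each stopped process $M^{T_n}=M_{T_n\wedge\,\cdot}$ is a uniformly integrable martingale (in particular $\mathsf E(|M_0|)<\infty$). For $\lambda\ge 0$ let $\tau_\lambda:=\inf\{t\ge 0 : |M_t|>\lambda\}$ (with $\inf\emptyset=\infty$), and let $\Delta M:=M-M_-$ be the jump process of $M$, where $M_{t-}:=\lim_{s\uparrow t}M_s$ for $t>0$ and $M_{0-}:=M_0$. Then $M$ is a martingale if and only if, for every $t\ge 0$, \begin{align*} &(\mathrm A')\quad \liminf_{\lambda\uparrow\infty}\ \lambda\,\mathsf P\Bigl(\sup_{s\in[0,t]}|M_s|>\lambda\Bigr)=0;\\ &(\mathrm B')\quad \lim_{\lambda\uparrow\infty}\ \mathsf E\bigl(\mathbf 1_{\{\tau_\lambda\le t\}}\,|\Delta M_{\tau_\lambda}|\bigr)=0;\quad\text{and}\\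 &(\mathrm C')\quad \mathsf E(|M_t|)<\infty. \end{align*} -/

import Mathlib

open MeasureTheory ProbabilityTheory Filter Topology
open scoped NNReal ENNReal

namespace LocMart

/-- A real-valued path indexed by `[0, ∞)` is càdlàg: right-continuous with (finite) left limits.
At `t = 0` the left-limit requirement is vacuous. -/
def IsCadlag (x : ℝ≥0 → ℝ) : Prop :=
  ∀ t : ℝ≥0, ContinuousWithinAt x (Set.Ici t) t ∧ ∃ l : ℝ, Tendsto x (𝓝[<] t) (𝓝 l)

variable {Ω : Type*} {mΩ : MeasurableSpace Ω}

/-- Uniformly integrable martingales. -/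
def IsUIMartingale (X : ℝ≥0 → Ω → ℝ) (𝓕 : Filtration ℝ≥0 mΩ) (P : Measure Ω) : Prop :=
  Martingale X 𝓕 P ∧ UniformIntegrable X 1 P

/-- Local martingales: adapted càdlàg processes `M` for which there is a localizing sequence
`τ 0 ≤ τ 1 ≤ ⋯ → ∞` (almost surely) of stopping times such that each stopped process
`M_{τ n ∧ ·}` is a uniformly integrable martingale. (There is no factor `1_{τ n > 0}`, so that `M_0`
is integrable.) -/
structure IsLocalMartingale (M : ℝ≥0 → Ω → ℝ) (𝓕 : Filtration ℝ≥0 mΩ) (P : Measure Ω) :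
    Prop where
  adapted : StronglyAdapted 𝓕 M
  cadlag : ∀ ω, IsCadlag (fun t => M t ω)
  localized : ∃ τ : ℕ → Ω → WithTop ℝ≥0, IsLocalizingSequence 𝓕 τ P ∧
    ∀ n, IsUIMartingale (stoppedProcess M (τ n)) 𝓕 P

/-- The first exit time `τ_l = inf {t ≥ 0 | |M_t| > l}` from `[-l, l]`, with `inf ∅ = ∞`. -/
noncomputable def exitTime (M : ℝ≥0 → Ω → ℝ) (l : ℝ) : Ω → WithTop ℝ≥0 :=
  hittingAfter M {x : ℝ | l < |x|} 0

/-- The jump process `ΔM = M - M_-`, with `M_{0-} = M_0`, that is, `ΔM_0 = 0`. -/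
noncomputable def jump (M : ℝ≥0 → Ω → ℝ) (t : ℝ≥0) (ω : Ω) : ℝ :=
  M t ω - Function.leftLim (fun s => M s ω) t

/-- The running supremum `sup_{s ∈ [0, t]} |M_s|`, with values in `[0, ∞]`. -/
noncomputable def runningSup (M : ℝ≥0 → Ω → ℝ) (t : ℝ≥0) (ω : Ω) : ℝ≥0∞ :=
  ⨆ s ∈ Set.Icc 0 t, ENNReal.ofReal |M s ω|

end LocMart

/-! Everything rests on optional stopping at the exit times τ_l. If M is a martingale, E(|M_{τ_l}|;
τ_l ≤ t) ≤ E(|M_t|; τ_l ≤ t) (`setLIntegral_exit_le`), and the right side vanishes as l → ∞ because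
càdlàg paths are bounded on [0, t]. At the exit, both l and half the jump are at most |M_{τ_l}|,
which gives (A') and (B').

Conversely, |M| ≤ l before the exit and |M| ≤ l + |ΔM| at the exit, up to a term for |M_0| > l. So
(B') makes the process stopped at τ_l, for large l, dominated on [0, t] by an integrable variable,
hence a true martingale (`setIntegral_capped_exitTime_eq`). Since M_t and M_{τ_l ∧ t} differ only on
{τ_l ≤ t}, their L¹ distance tends to 0 along levels realizing the liminf in (A'), and the
martingale identity passes to the limit (`setIntegral_eq`). -/

namespace LocMart

/-! ### Approximation of stopping times from the right by countably valued ones -/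

/-- The smallest multiple of `1 / (n + 1)` that is strictly larger than `r`, capped at `t`. -/
noncomputable def gridAbove (t : ℝ≥0) (n : ℕ) (r : ℝ≥0) : ℝ≥0 :=
  min t ((⌊(n + 1) * r⌋₊ + 1) / (n + 1))

lemma gridAbove_le (t : ℝ≥0) (n : ℕ) (r : ℝ≥0) : gridAbove t n r ≤ t := min_le_left _ _

lemma le_gridAbove {t r : ℝ≥0} (n : ℕ) (h : r ≤ t) : r ≤ gridAbove t n r := by
  refine le_min h ?_
  rw [le_div_iff₀ (by positivity), mul_comm]
  exact (Nat.lt_floor_add_one _).le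

lemma gridAbove_le_add (t : ℝ≥0) (n : ℕ) (r : ℝ≥0) : gridAbove t n r ≤ r + 1 / (n + 1) := by
  refine (min_le_right _ _).trans ?_
  rw [add_div]
  gcongr
  rw [div_le_iff₀ (by positivity), mul_comm]
  exact Nat.floor_le (by positivity)

lemma tendsto_gridAbove {t r : ℝ≥0} (h : r ≤ t) :
    Tendsto (fun n => gridAbove t n r) atTop (𝓝[≥] r) := by
  refine tendsto_nhdsWithin_iff.2 ⟨?_, .of_forall fun n => le_gridAbove n h⟩
  refine tendsto_of_tendsto_of_tendsto_of_le_of_le tendsto_const_nhds ?_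
    (fun n => le_gridAbove n h) (fun n => gridAbove_le_add t n r)
  simpa using tendsto_const_nhds.add (tendsto_one_div_add_atTop_nhds_zero_nat (𝕜 := ℝ≥0))

lemma countable_range_gridAbove {Ω : Type*} (t : ℝ≥0) (n : ℕ) (σ : Ω → ℝ≥0) :
    (Set.range fun ω => (gridAbove t n (σ ω) : WithTop ℝ≥0)).Countable := by
  refine (Set.countable_range
    fun k : ℕ => ((min t ((k + 1) / (n + 1)) : ℝ≥0) : WithTop ℝ≥0)).mono ?_
  rintro _ ⟨ω, rfl⟩
  exact ⟨⌊(n + 1) * σ ω⌋₊, rfl⟩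

/-- Because the grid point is strictly above `r`, the event is a strict inequality against the last
grid point before `u`, so it is decided by time `u`. -/
lemma gridAbove_le_iff {t u r : ℝ≥0} {n : ℕ} (h : u < t) :
    gridAbove t n r ≤ u ↔ r < ⌊(n + 1) * u⌋₊ / (n + 1) := by
  have hn : (0 : ℝ≥0) < n + 1 := by positivity
  rw [gridAbove, min_le_iff, or_iff_right h.not_ge, div_le_iff₀ hn, lt_div_iff₀ hn, mul_comm u,
    mul_comm r, ← Nat.floor_lt (by positivity), ← Nat.add_one_le_iff,
    Nat.le_floor_iff (by positivity)]
  norm_cast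

variable {Ω : Type*} {mΩ : MeasurableSpace Ω} {P : Measure Ω} {𝓕 : Filtration ℝ≥0 mΩ}

lemma isStoppingTime_gridAbove {σ : Ω → ℝ≥0} (hσ : IsStoppingTime 𝓕 fun ω => (σ ω : WithTop ℝ≥0))
    (t : ℝ≥0) (n : ℕ) :
    IsStoppingTime 𝓕 fun ω => (gridAbove t n (σ ω) : WithTop ℝ≥0) := by
  intro u
  simp only [WithTop.coe_le_coe]
  rcases le_or_gt t u with h | h
  · simp [(gridAbove_le t n _).trans h]
  · simp only [gridAbove_le_iff h]
    have hle : (⌊(n + 1) * u⌋₊ / (n + 1) : ℝ≥0) ≤ u := by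
      rw [div_le_iff₀ (by positivity), mul_comm]
      exact Nat.floor_le (by positivity)
    have h := hσ.measurableSet_lt_le hle
    simpa only [WithTop.coe_lt_coe] using h

/-! ### Optional stopping in continuous time -/

section OptionalStopping

variable [IsProbabilityMeasure P] {X : ℝ≥0 → Ω → ℝ} {σ : Ω → ℝ≥0} {t : ℝ≥0}

lemma sampled_gridAbove_ae_eq_condExp (hX : Martingale X 𝓕 P)
    (hσ : IsStoppingTime 𝓕 fun ω => (σ ω : WithTop ℝ≥0)) (n : ℕ) :
    (fun ω => X (gridAbove t n (σ ω)) ω) =ᵐ[P]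
      P[X t | (isStoppingTime_gridAbove hσ t n).measurableSpace] := by
  have h := hX.stoppedValue_ae_eq_condExp_of_le_const_of_countable_range
    (isStoppingTime_gridAbove hσ t n)
    (fun ω => WithTop.coe_le_coe.2 (gridAbove_le t n (σ ω))) (countable_range_gridAbove t n σ)
  exact h

lemma tendsto_sampled_gridAbove
    (hr : ∀ ω s, ContinuousWithinAt (fun s => X s ω) (Set.Ici s) s) (hσt : ∀ ω, σ ω ≤ t) (ω : Ω) :
    Tendsto (fun n => X (gridAbove t n (σ ω)) ω) atTop (𝓝 (X (σ ω) ω)) :=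
  (hr ω (σ ω)).tendsto.comp (tendsto_gridAbove (hσt ω))

lemma aestronglyMeasurable_sampled (hX : Martingale X 𝓕 P)
    (hr : ∀ ω s, ContinuousWithinAt (fun s => X s ω) (Set.Ici s) s)
    (hσ : IsStoppingTime 𝓕 fun ω => (σ ω : WithTop ℝ≥0)) (hσt : ∀ ω, σ ω ≤ t) :
    AEStronglyMeasurable (fun ω => X (σ ω) ω) P :=
  aestronglyMeasurable_of_tendsto_ae atTop
    (fun n => integrable_condExp.aestronglyMeasurable.congr
      (sampled_gridAbove_ae_eq_condExp (t := t) hX hσ n).symm)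
    (ae_of_all _ fun ω => tendsto_sampled_gridAbove hr hσt ω)

/-- Optional stopping for the absolute value of a right-continuous martingale. -/
lemma setLIntegral_sampled_le (hX : Martingale X 𝓕 P)
    (hr : ∀ ω s, ContinuousWithinAt (fun s => X s ω) (Set.Ici s) s)
    (hσ : IsStoppingTime 𝓕 fun ω => (σ ω : WithTop ℝ≥0)) (hσt : ∀ ω, σ ω ≤ t) {A : Set Ω}
    (hA : MeasurableSet[hσ.measurableSpace] A) :
    ∫⁻ ω in A, ‖X (σ ω) ω‖ₑ ∂P ≤ ∫⁻ ω in A, ‖X t ω‖ₑ ∂P := by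
  calc ∫⁻ ω in A, ‖X (σ ω) ω‖ₑ ∂P
      = ∫⁻ ω in A, liminf (fun n => ‖X (gridAbove t n (σ ω)) ω‖ₑ) atTop ∂P := by
        refine lintegral_congr fun ω => ?_
        exact ((tendsto_sampled_gridAbove hr hσt ω).enorm.liminf_eq).symm
    _ ≤ liminf (fun n => ∫⁻ ω in A, ‖X (gridAbove t n (σ ω)) ω‖ₑ ∂P) atTop :=
        lintegral_liminf_le' fun n => ((integrable_condExp.aestronglyMeasurable.congr
          (sampled_gridAbove_ae_eq_condExp (t := t) hX hσ n).symm).restrict).enorm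
    _ ≤ liminf (fun _ : ℕ => ∫⁻ ω in A, ‖X t ω‖ₑ ∂P) atTop := by
        refine liminf_le_liminf (.of_forall fun n => ?_)
        -- The approximating times lie above σ, so `A` belongs to their σ-algebras too and
        -- conditional Jensen applies on `A`; Fatou has reduced the claim to them.
        have hle := hσ.measurableSpace_mono (isStoppingTime_gridAbove hσ t n)
          (fun ω => WithTop.coe_le_coe.2 (le_gridAbove n (hσt ω)))
        have heq : ∀ᵐ ω ∂P.restrict A, ‖X (gridAbove t n (σ ω)) ω‖ₑ =
            ‖(P[X t | (isStoppingTime_gridAbove hσ t n).measurableSpace]) ω‖ₑ :=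
          ae_restrict_of_ae ((sampled_gridAbove_ae_eq_condExp (t := t) hX hσ n).mono
            fun ω h => congrArg enorm h)
        rw [lintegral_congr_ae heq,
          ← ofReal_integral_norm_eq_lintegral_enorm integrable_condExp.restrict,
          ← ofReal_integral_norm_eq_lintegral_enorm (hX.integrable t).restrict]
        exact ENNReal.ofReal_le_ofReal (setIntegral_abs_condExp_le (hle A hA) (X t))
    _ = _ := by simp

lemma integrable_sampled (hX : Martingale X 𝓕 P)
    (hr : ∀ ω s, ContinuousWithinAt (fun s => X s ω) (Set.Ici s) s)
    (hσ : IsStoppingTime 𝓕 fun ω => (σ ω : WithTop ℝ≥0)) (hσt : ∀ ω, σ ω ≤ t) :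
    Integrable (fun ω => X (σ ω) ω) P := by
  refine ⟨aestronglyMeasurable_sampled hX hr hσ hσt, ?_⟩
  have h := setLIntegral_sampled_le hX hr hσ hσt (A := Set.univ) MeasurableSet.univ
  simp only [Measure.restrict_univ] at h
  exact h.trans_lt (hX.integrable t).2

/-- Optional stopping for right-continuous martingales and bounded stopping times. -/
lemma integral_sampled (hX : Martingale X 𝓕 P)
    (hr : ∀ ω s, ContinuousWithinAt (fun s => X s ω) (Set.Ici s) s)
    (hσ : IsStoppingTime 𝓕 fun ω => (σ ω : WithTop ℝ≥0)) (hσt : ∀ ω, σ ω ≤ t) :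
    ∫ ω, X (σ ω) ω ∂P = ∫ ω, X t ω ∂P := by
  -- Conditional expectations of one integrable variable are uniformly integrable, so pointwise
  -- convergence becomes L¹ convergence.
  have hui := ((hX.integrable t).uniformIntegrable_condExp
    (fun n => (isStoppingTime_gridAbove hσ t n).measurableSpace_le)).ae_eq
    (fun n => (sampled_gridAbove_ae_eq_condExp (t := t) hX hσ n).symm)
  have hL := tendsto_Lp_finite_of_tendsto_ae le_rfl ENNReal.one_ne_top hui.1
    (memLp_one_iff_integrable.2 (integrable_sampled hX hr hσ hσt)) hui.2.1
    (ae_of_all _ fun ω => tendsto_sampled_gridAbove hr hσt ω)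
  have hlim := tendsto_integral_of_L1' _ (integrable_sampled hX hr hσ hσt).1
    (.of_forall fun n => integrable_condExp.congr
      (sampled_gridAbove_ae_eq_condExp (t := t) hX hσ n).symm) hL
  refine tendsto_nhds_unique hlim (tendsto_const_nhds.congr fun n => ?_)
  rw [integral_congr_ae (sampled_gridAbove_ae_eq_condExp (t := t) hX hσ n),
    integral_condExp (isStoppingTime_gridAbove hσ t n).measurableSpace_le]

end OptionalStopping

/-! ### Stopping at a bounded time -/

/-- The bounded time `τ ∧ t`, as a map into `ℝ≥0`. -/
noncomputable def capped (τ : Ω → WithTop ℝ≥0) (t : ℝ≥0) (ω : Ω) : ℝ≥0 :=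
  (min (τ ω) t).untopA

lemma coe_capped (τ : Ω → WithTop ℝ≥0) (t : ℝ≥0) (ω : Ω) :
    (capped τ t ω : WithTop ℝ≥0) = min (τ ω) t := by
  have h : min (τ ω) (t : WithTop ℝ≥0) ≠ ⊤ := ((min_le_right _ _).trans_lt (WithTop.coe_lt_top t)).ne
  rw [capped, WithTop.untopA_eq_untop h, WithTop.coe_untop]

lemma capped_le (τ : Ω → WithTop ℝ≥0) (t : ℝ≥0) (ω : Ω) : capped τ t ω ≤ t := by
  rw [← WithTop.coe_le_coe, coe_capped]
  exact min_le_right _ _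

lemma capped_of_le {τ : Ω → WithTop ℝ≥0} {t : ℝ≥0} {ω : Ω} (h : t ≤ τ ω) : capped τ t ω = t := by
  rw [← WithTop.coe_inj, coe_capped, min_eq_right h]

lemma coe_capped_of_ge {τ : Ω → WithTop ℝ≥0} {t : ℝ≥0} {ω : Ω} (h : τ ω ≤ t) :
    (capped τ t ω : WithTop ℝ≥0) = τ ω := by
  rw [coe_capped, min_eq_left h]

lemma isStoppingTime_capped {τ : Ω → WithTop ℝ≥0} (hτ : IsStoppingTime 𝓕 τ) (t : ℝ≥0) :
    IsStoppingTime 𝓕 fun ω => (capped τ t ω : WithTop ℝ≥0) := by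
  simpa only [coe_capped] using hτ.min_const t

lemma measurableSet_le_capped {τ : Ω → WithTop ℝ≥0} (hτ : IsStoppingTime 𝓕 τ) (t : ℝ≥0) :
    MeasurableSet[(isStoppingTime_capped hτ t).measurableSpace] {ω | τ ω ≤ t} := by
  have h : MeasurableSet[(hτ.min_const t).measurableSpace] {ω | τ ω ≤ t} :=
    (hτ.measurableSet_min_const_iff _).2 ⟨hτ.measurableSet_le' t, hτ.measurableSet_le t⟩
  rw [IsStoppingTime.measurableSet] at h ⊢
  simpa only [coe_capped] using h

/-- The martingale property is preserved under stopping. -/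
lemma setIntegral_capped_eq [IsProbabilityMeasure P] {X : ℝ≥0 → Ω → ℝ} (hX : Martingale X 𝓕 P)
    (hr : ∀ ω s, ContinuousWithinAt (fun s => X s ω) (Set.Ici s) s)
    {τ : Ω → WithTop ℝ≥0} (hτ : IsStoppingTime 𝓕 τ) {s t : ℝ≥0} (hst : s ≤ t) {A : Set Ω}
    (hA : MeasurableSet[𝓕 s] A) :
    ∫ ω in A, X (capped τ s ω) ω ∂P = ∫ ω in A, X (capped τ t ω) ω ∂P := by
  classical
  have hA' : MeasurableSet A := 𝓕.le s A hA
  -- Switching from τ ∧ t to τ ∧ s on `A` gives a bounded stopping time, so the expectation is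
  -- unchanged; the contributions of `Aᶜ` cancel.
  let ρ : Ω → ℝ≥0 := A.piecewise (capped τ s) (capped τ t)
  have hρt : ∀ ω, ρ ω ≤ t := fun ω => by
    by_cases h : ω ∈ A
    · simpa [ρ, h] using (capped_le τ s ω).trans hst
    · simpa [ρ, h] using capped_le τ t ω
  have hρ : IsStoppingTime 𝓕 fun ω => (ρ ω : WithTop ℝ≥0) := by
    intro u
    have hs := isStoppingTime_capped hτ s u
    have ht := isStoppingTime_capped hτ t u
    -- Before `s` both capped times reduce to τ, so `A` plays no role; from `s` on, `A` is known and
    -- lies in the event.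
    rcases lt_or_ge u s with hu | hu
    · convert ht using 1
      ext ω
      by_cases h : ω ∈ A
      · simp only [Set.mem_ofPred_eq, ρ, Set.piecewise_eq_of_mem _ _ _ h]
        rw [coe_capped, coe_capped, min_le_iff, min_le_iff, WithTop.coe_le_coe, WithTop.coe_le_coe,
          or_iff_left hu.not_ge, or_iff_left (hu.trans_le hst).not_ge]
      · simp only [Set.mem_ofPred_eq, ρ, Set.piecewise_eq_of_notMem _ _ _ h]
    · have hAu : MeasurableSet[𝓕 u] A := 𝓕.mono hu A hA
      convert hAu.union ht using 1
      ext ω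
      by_cases h : ω ∈ A
      · have := WithTop.coe_le_coe.2 ((capped_le τ s ω).trans hu)
        simpa [ρ, h] using this
      · simp [ρ, h]
  have hit := integrable_sampled hX hr (isStoppingTime_capped hτ t) (capped_le τ t)
  have e := (integral_sampled hX hr hρ hρt).trans
    (integral_sampled hX hr (isStoppingTime_capped hτ t) (capped_le τ t)).symm
  rw [← integral_add_compl hA' (integrable_sampled hX hr hρ hρt),
    ← integral_add_compl hA' hit] at e
  have e1 : ∫ ω in A, X (ρ ω) ω ∂P = ∫ ω in A, X (capped τ s ω) ω ∂P :=
    setIntegral_congr_fun hA' fun ω h => by simp [ρ, h]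
  have e2 : ∫ ω in Aᶜ, X (ρ ω) ω ∂P = ∫ ω in Aᶜ, X (capped τ t ω) ω ∂P :=
    setIntegral_congr_fun hA'.compl fun ω h => by
      simp [ρ, Set.piecewise_eq_of_notMem _ _ _ (Set.notMem_of_mem_compl h)]
  rw [e1, e2] at e
  exact add_right_cancel e

lemma continuousWithinAt_stoppedProcess {M : ℝ≥0 → Ω → ℝ}
    (hr : ∀ ω s, ContinuousWithinAt (fun s => M s ω) (Set.Ici s) s) (τ : Ω → WithTop ℝ≥0)
    (ω : Ω) (s : ℝ≥0) :
    ContinuousWithinAt (fun s => stoppedProcess M τ s ω) (Set.Ici s) s := by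
  rcases h : τ ω with _ | r
  · have e : (fun s => stoppedProcess M τ s ω) = fun s => M s ω := by
      funext u
      rw [stoppedProcess_eq_of_le (h ▸ le_top)]
    exact e ▸ hr ω s
  · have e : (fun s => stoppedProcess M τ s ω) = (fun s => M s ω) ∘ fun s => min s r := by
      funext u
      simp only [stoppedProcess, h, WithTop.some_eq_coe, ← WithTop.coe_min, Function.comp]
      rfl
    rw [e]
    refine ContinuousWithinAt.comp (t := Set.Ici (min s r)) (hr ω (min s r))
      (f := fun s => min s r) (by fun_prop) fun u hu => ?_
    exact min_le_min_right r hu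

/-! ### Path properties and measurability of the exit times -/

section ExitTime

variable {M : ℝ≥0 → Ω → ℝ} {l : ℝ} {ω : Ω}

lemma abs_le_of_lt_exitTime {s : ℝ≥0} (h : s < exitTime M l ω) : |M s ω| ≤ l :=
  not_lt.1 (notMem_of_lt_hittingAfter (u := M) (s := {x | l < |x|}) (n := 0) h zero_le)

lemma exitTime_lt_iff {u : ℝ≥0} : exitTime M l ω < u ↔ ∃ s < u, l < |M s ω| := by
  constructor
  · intro h
    obtain ⟨s, hs, hl⟩ := hittingAfter_lt_iff.1 h
    exact ⟨s, hs.2, hl⟩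
  · rintro ⟨s, hs, hl⟩
    exact hittingAfter_lt_iff.2 ⟨s, ⟨zero_le, hs⟩, hl⟩

lemma exitTime_le_of_lt_abs {s : ℝ≥0} (h : l < |M s ω|) : exitTime M l ω ≤ s :=
  not_lt.1 fun hs => (abs_le_of_lt_exitTime hs).not_gt h

/-- Only the weak inequality survives: the level may be exceeded just after `r`, and
right-continuity passes to the limit. -/
lemma le_abs_of_exitTime_eq {r : ℝ≥0}
    (hr : ContinuousWithinAt (fun s => M s ω) (Set.Ici r) r) (h : exitTime M l ω = r) :
    l ≤ |M r ω| := by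
  by_contra! hlt
  have hev : ∀ᶠ s in 𝓝[≥] r, |M s ω| < l := hr.abs.eventually_lt_const hlt
  obtain ⟨u, hu, hsub⟩ := (mem_nhdsGE_iff_exists_Ico_subset).1 hev
  obtain ⟨s, hs, hl⟩ := exitTime_lt_iff.1 (h.trans_lt (WithTop.coe_lt_coe.2 hu))
  have hrs : r ≤ s := WithTop.coe_le_coe.1 (h ▸ exitTime_le_of_lt_abs hl)
  exact lt_asymm hl (hsub ⟨hrs, hs⟩)

lemma jump_zero (M : ℝ≥0 → Ω → ℝ) (ω : Ω) : jump M 0 ω = 0 := by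
  rw [jump, leftLim_eq_of_isBot (fun _ => zero_le), sub_self]

lemma abs_leftLim_le_of_exitTime_eq (hM : IsCadlag fun s => M s ω) {r : ℝ≥0} (hr0 : 0 < r)
    (h : exitTime M l ω = r) : |Function.leftLim (fun s => M s ω) r| ≤ l := by
  obtain ⟨a, ha⟩ := (hM r).2
  have : (𝓝[<] r).NeBot := nhdsLT_neBot_of_exists_lt ⟨0, hr0⟩
  rw [leftLim_eq_of_tendsto ha]
  refine le_of_tendsto ha.abs (eventually_nhdsWithin_of_forall fun s hs => ?_)
  exact abs_le_of_lt_exitTime (h ▸ WithTop.coe_lt_coe.2 hs)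

lemma abs_jump_le_of_exitTime_eq (hM : IsCadlag fun s => M s ω) {r : ℝ≥0}
    (h : exitTime M l ω = r) : |jump M r ω| ≤ 2 * |M r ω| := by
  rcases eq_zero_or_pos r with rfl | hr
  · rw [jump_zero, abs_zero]; positivity
  · have h1 := abs_leftLim_le_of_exitTime_eq hM hr h
    have h2 := le_abs_of_exitTime_eq (hM r).1 h
    have h3 := abs_sub (M r ω) (Function.leftLim (fun s => M s ω) r)
    rw [jump]
    linarith

/-- The left limit at the exit is at most `l`, so the overshoot comes from the jump. The indicator
covers exit at time 0, where the jump is 0 by convention. -/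
lemma abs_le_of_exitTime_eq (hM : IsCadlag fun s => M s ω) (hl : 0 ≤ l) {r : ℝ≥0}
    (h : exitTime M l ω = r) :
    |M r ω| ≤ l + |jump M r ω| + {ω | l < |M 0 ω|}.indicator (fun ω => |M 0 ω|) ω := by
  have hind : 0 ≤ {ω | l < |M 0 ω|}.indicator (fun ω => |M 0 ω|) ω :=
    Set.indicator_nonneg (fun _ _ => abs_nonneg _) _
  rcases eq_zero_or_pos r with rfl | hr
  · by_cases h0 : l < |M 0 ω|
    · rw [Set.indicator_of_mem (by exact h0)]
      have := abs_nonneg (jump M 0 ω)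
      linarith
    · have := abs_nonneg (jump M 0 ω)
      linarith
  · have h1 := abs_leftLim_le_of_exitTime_eq hM hr h
    have h3 := abs_add_le (jump M r ω) (Function.leftLim (fun s => M s ω) r)
    rw [jump, sub_add_cancel] at h3
    rw [jump]
    linarith

lemma exists_abs_le_of_isCadlag {x : ℝ≥0 → ℝ} (hx : IsCadlag x) (t : ℝ≥0) :
    ∃ C, ∀ s ≤ t, |x s| ≤ C := by
  suffices ∃ C, ∀ s ∈ Set.Icc 0 t, |x s| ≤ C by
    obtain ⟨C, hC⟩ := this
    exact ⟨C, fun s hs => hC s ⟨zero_le, hs⟩⟩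
  refine isCompact_Icc.induction_on (p := fun S => ∃ C, ∀ s ∈ S, |x s| ≤ C) ⟨0, by simp⟩
    (fun S T hST ⟨C, hC⟩ => ⟨C, fun s hs => hC s (hST hs)⟩) ?_ ?_
  · rintro S T ⟨C, hC⟩ ⟨D, hD⟩
    refine ⟨max C D, fun s hs => ?_⟩
    rcases hs with hs | hs
    · exact (hC s hs).trans (le_max_left _ _)
    · exact (hD s hs).trans (le_max_right _ _)
  · intro r _
    obtain ⟨hr, a, ha⟩ := hx r
    have h1 : ∀ᶠ s in 𝓝[≥] r, |x s| ≤ max (|x r| + 1) (|a| + 1) :=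
      (hr.abs.eventually_lt_const (lt_add_one _)).mono fun s hs => hs.le.trans (le_max_left _ _)
    have h2 : ∀ᶠ s in 𝓝[<] r, |x s| ≤ max (|x r| + 1) (|a| + 1) :=
      (ha.abs.eventually_lt_const (lt_add_one _)).mono fun s hs => hs.le.trans (le_max_right _ _)
    have h3 : ∀ᶠ s in 𝓝 r, |x s| ≤ max (|x r| + 1) (|a| + 1) := by
      rw [← nhdsLT_sup_nhdsGE, eventually_sup]
      exact ⟨h2, h1⟩
    exact ⟨_, mem_nhdsWithin_of_mem_nhds h3, _, fun s hs => hs⟩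

lemma eventually_lt_exitTime (hM : IsCadlag fun s => M s ω) (t : ℝ≥0) :
    ∀ᶠ l in atTop, t < exitTime M l ω := by
  -- A bound on [0, t] alone would not exclude exit exactly at `t`.
  obtain ⟨C, hC⟩ := exists_abs_le_of_isCadlag hM (t + 1)
  filter_upwards [eventually_ge_atTop C] with l hl
  refine lt_of_lt_of_le (WithTop.coe_lt_coe.2 (lt_add_one t)) (not_lt.1 fun h => ?_)
  obtain ⟨s, hs, hls⟩ := exitTime_lt_iff.1 h
  linarith [hC s hs.le]

lemma exitTime_le_of_lt_runningSup {t : ℝ≥0} (h : ENNReal.ofReal l < runningSup M t ω) :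
    exitTime M l ω ≤ t := by
  simp only [runningSup, lt_iSup_iff] at h
  obtain ⟨s, hs, hl⟩ := h
  exact (exitTime_le_of_lt_abs (lt_of_not_ge fun h => (ENNReal.ofReal_le_ofReal h).not_gt hl)).trans
    (WithTop.coe_le_coe.2 hs.2)

/-- Strictness is needed: after exit exactly at `t` the level may be exceeded only later. This is
why (A') is later used at time `t + 1`. -/
lemma lt_runningSup_of_exitTime_lt (hl : 0 ≤ l) {t : ℝ≥0} (h : exitTime M l ω < t) :
    ENNReal.ofReal l < runningSup M t ω := by
  obtain ⟨s, hs, hls⟩ := exitTime_lt_iff.1 h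
  exact ((ENNReal.ofReal_lt_ofReal_iff_of_nonneg hl).2 hls).trans_le
    (le_iSup₂ (f := fun s (_ : s ∈ Set.Icc 0 t) => ENNReal.ofReal |M s ω|) s ⟨zero_le, hs.le⟩)

/-- Provides a dominating variable for the stopped process that does not depend on `u`. -/
lemma abs_capped_exitTime_le {u t : ℝ≥0} (hut : u ≤ t) :
    |M (capped (exitTime M l) u ω) ω| ≤ max l |M (capped (exitTime M l) t ω) ω| := by
  rcases le_or_gt (exitTime M l ω) u with h | h
  · have e : capped (exitTime M l) u ω = capped (exitTime M l) t ω := by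
      rw [← WithTop.coe_inj, coe_capped_of_ge h,
        coe_capped_of_ge (h.trans (WithTop.coe_le_coe.2 hut))]
    rw [e]
    exact le_max_right _ _
  · rw [capped_of_le h.le]
    exact (abs_le_of_lt_exitTime h).trans (le_max_left _ _)

lemma exists_mem_lt_abs {D : Set ℝ≥0} (hD : Dense D)
    (hr : ∀ s, ContinuousWithinAt (fun s => M s ω) (Set.Ici s) s)
    {u s : ℝ≥0} (hs : s < u) (hl : l < |M s ω|) : ∃ q ∈ D, q < u ∧ l < |M q ω| := by
  have hev : ∀ᶠ s in 𝓝[≥] s, l < |M s ω| := (hr s).abs.eventually_const_lt hl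
  obtain ⟨v, hv, hsub⟩ := (mem_nhdsGE_iff_exists_Ico_subset).1 hev
  obtain ⟨q, hqD, hq1, hq2⟩ := hD.exists_between (lt_min hs hv)
  exact ⟨q, hqD, hq2.trans_le (min_le_left _ _),
    hsub ⟨hq1.le, hq2.trans_le (min_le_right _ _)⟩⟩

lemma isStoppingTime_exitTime [𝓕.IsRightContinuous] (hM : StronglyAdapted 𝓕 M)
    (hr : ∀ ω s, ContinuousWithinAt (fun s => M s ω) (Set.Ici s) s) (l : ℝ) :
    IsStoppingTime 𝓕 (exitTime M l) := by
  -- Right-continuity of the filtration allows strict inequalities; right-continuity of paths then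
  -- reduces to countably many times.
  refine isStoppingTime_of_measurableSet_lt_of_isRightContinuous fun u => ?_
  obtain ⟨D, hDc, hD⟩ := TopologicalSpace.exists_countable_dense ℝ≥0
  have e : {ω | exitTime M l ω < u} = ⋃ q ∈ D ∩ Set.Iio u, {ω | l < |M q ω|} := by
    ext ω
    simp only [Set.mem_ofPred_eq, exitTime_lt_iff, Set.mem_iUnion, exists_prop]
    refine ⟨fun ⟨s, hs, h⟩ => ?_, fun ⟨q, hq, h⟩ => ⟨q, hq.2, h⟩⟩
    obtain ⟨q, hqD, hq, h⟩ := exists_mem_lt_abs hD (hr ω) hs h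
    exact ⟨q, ⟨hqD, hq⟩, h⟩
  rw [e]
  refine MeasurableSet.biUnion (hDc.mono Set.inter_subset_left) fun q hq => ?_
  have hm : Measurable[𝓕 q] (fun ω => |M q ω|) := (hM q).norm.measurable
  exact 𝓕.mono (le_of_lt hq.2) _ (hm measurableSet_Ioi)

end ExitTime

/-! ### Vanishing of integrals over exit events and tails -/

variable {M : ℝ≥0 → Ω → ℝ}

lemma stoppedValue_exitTime_of_le (u : ℝ≥0 → Ω → ℝ) {l : ℝ} {t : ℝ≥0} {ω : Ω}
    (h : exitTime M l ω ≤ t) :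
    stoppedValue u (exitTime M l) ω = u (capped (exitTime M l) t ω) ω := by
  rw [stoppedValue, ← coe_capped_of_ge h]
  rfl

lemma tendsto_setLIntegral_exitTime_le (hM : ∀ ω, IsCadlag fun s => M s ω)
    (hτ : ∀ l, IsStoppingTime 𝓕 (exitTime M l)) {f : Ω → ℝ} (hf : Integrable f P)
    (hfm : Measurable f) (t : ℝ≥0) :
    Tendsto (fun l => ∫⁻ ω in {ω | exitTime M l ω ≤ t}, ‖f ω‖ₑ ∂P) atTop (𝓝 0) := by
  have hms : ∀ l, MeasurableSet {ω | exitTime M l ω ≤ t} := fun l =>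
    𝓕.le t _ ((hτ l).measurableSet_le t)
  simp_rw [← lintegral_indicator (hms _)]
  rw [← lintegral_zero (μ := P) (α := Ω)]
  refine tendsto_lintegral_filter_of_dominated_convergence (fun ω => ‖f ω‖ₑ)
    (.of_forall fun l => ?_) (.of_forall fun l => ae_of_all _ fun ω => ?_) hf.2.ne
    (ae_of_all _ fun ω => ?_)
  · exact hfm.enorm.indicator (hms l)
  · exact Set.indicator_le_self _ _ _
  · refine tendsto_const_nhds.congr' ?_
    filter_upwards [eventually_lt_exitTime (hM ω) t] with l hl
    have hω : ω ∉ {ω | exitTime M l ω ≤ t} := not_le.2 hl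
    exact (Set.indicator_of_notMem hω _).symm

lemma tendsto_lintegral_indicator_lt_abs {f : Ω → ℝ} (hf : Integrable f P)
    (hfm : Measurable f) :
    Tendsto (fun l : ℝ => ∫⁻ ω, ‖{ω | l < |f ω|}.indicator (fun ω => |f ω|) ω‖ₑ ∂P) atTop (𝓝 0) := by
  rw [← lintegral_zero (μ := P) (α := Ω)]
  have hms : ∀ l, MeasurableSet {ω | l < |f ω|} := fun l => hfm.norm measurableSet_Ioi
  refine tendsto_lintegral_filter_of_dominated_convergence (fun ω => ‖f ω‖ₑ)
    (.of_forall fun l => (hfm.norm.indicator (hms l)).enorm)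
    (.of_forall fun l => ae_of_all _ fun ω => ?_) hf.2.ne
    (ae_of_all _ fun ω => ?_)
  · rw [← Real.enorm_abs (f ω)]
    exact enorm_indicator_le_enorm_self _ _
  · refine tendsto_const_nhds.congr' ?_
    filter_upwards [eventually_ge_atTop |f ω|] with l hl
    have hω : ω ∉ {ω | l < |f ω|} := not_lt.2 hl
    rw [Set.indicator_of_notMem hω, enorm_zero]

/-! ### Necessity: maximal and jump estimates for martingales -/

section Necessity

variable [IsProbabilityMeasure P]

lemma setLIntegral_exit_le (hM : Martingale M 𝓕 P) (hc : ∀ ω, IsCadlag fun s => M s ω) {l : ℝ}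
    (hτ : IsStoppingTime 𝓕 (exitTime M l)) (t : ℝ≥0) :
    ∫⁻ ω in {ω | exitTime M l ω ≤ t}, ‖M (capped (exitTime M l) t ω) ω‖ₑ ∂P ≤
      ∫⁻ ω in {ω | exitTime M l ω ≤ t}, ‖M t ω‖ₑ ∂P :=
  setLIntegral_sampled_le hM (fun ω s => (hc ω s).1) (isStoppingTime_capped hτ t)
    (capped_le _ t) (measurableSet_le_capped hτ t)

/-- Doob's maximal inequality for the exit time. -/
lemma mul_measure_exitTime_le (hM : Martingale M 𝓕 P) (hc : ∀ ω, IsCadlag fun s => M s ω) {l : ℝ}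
    (hτ : IsStoppingTime 𝓕 (exitTime M l)) (t : ℝ≥0) :
    ENNReal.ofReal l * P {ω | exitTime M l ω ≤ t} ≤
      ∫⁻ ω in {ω | exitTime M l ω ≤ t}, ‖M t ω‖ₑ ∂P := by
  refine le_trans ?_ (setLIntegral_exit_le hM hc hτ t)
  rw [← setLIntegral_const]
  refine setLIntegral_mono' (𝓕.le t _ (hτ.measurableSet_le t)) fun ω hω => ?_
  rw [← Real.enorm_abs, Real.enorm_of_nonneg (abs_nonneg _)]
  exact ENNReal.ofReal_le_ofReal
    (le_abs_of_exitTime_eq (hc ω _).1 (coe_capped_of_ge hω).symm)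

lemma lintegral_indicator_jump_le (hM : Martingale M 𝓕 P) (hc : ∀ ω, IsCadlag fun s => M s ω)
    {l : ℝ} (hτ : IsStoppingTime 𝓕 (exitTime M l)) (t : ℝ≥0) :
    ∫⁻ ω, {ω | exitTime M l ω ≤ t}.indicator
      (fun ω => ENNReal.ofReal |stoppedValue (jump M) (exitTime M l) ω|) ω ∂P ≤
      2 * ∫⁻ ω in {ω | exitTime M l ω ≤ t}, ‖M t ω‖ₑ ∂P := by
  have hms : MeasurableSet {ω | exitTime M l ω ≤ t} := 𝓕.le t _ (hτ.measurableSet_le t)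
  rw [lintegral_indicator hms]
  refine le_trans ?_ (mul_le_mul_right (setLIntegral_exit_le hM hc hτ t) 2)
  rw [← lintegral_const_mul' _ _ ENNReal.ofNat_ne_top]
  refine setLIntegral_mono' hms fun ω hω => ?_
  rw [stoppedValue_exitTime_of_le _ hω, ← Real.enorm_abs (M _ ω),
    Real.enorm_of_nonneg (abs_nonneg _), ← ENNReal.ofReal_ofNat 2,
    ← ENNReal.ofReal_mul zero_le_two]
  exact ENNReal.ofReal_le_ofReal
    (abs_jump_le_of_exitTime_eq (hc ω) (coe_capped_of_ge hω).symm)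

end Necessity

/-! ### Sufficiency: stopped local martingales and removal of the stopping -/

lemma IsLocalMartingale.integrable_zero (hM : IsLocalMartingale M 𝓕 P) : Integrable (M 0) P := by
  obtain ⟨T, -, hT⟩ := hM.localized
  have h := (hT 0).1.integrable 0
  have e : stoppedProcess M (T 0) 0 = M 0 := by
    funext ω
    exact stoppedProcess_eq_of_le (by simp)
  rwa [e] at h

lemma eventually_stoppedProcess_eq {T : ℕ → Ω → WithTop ℝ≥0} {ω : Ω}
    (h : Tendsto (T · ω) atTop (𝓝 ⊤)) (u : ℝ≥0) :
    ∀ᶠ n in atTop, stoppedProcess M (T n) u ω = M u ω :=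
  (h.eventually_const_lt (WithTop.coe_lt_top u)).mono fun _ hn => stoppedProcess_eq_of_le hn.le

lemma IsLocalMartingale.aestronglyMeasurable_capped [IsProbabilityMeasure P]
    (hM : IsLocalMartingale M 𝓕 P)
    {τ : Ω → WithTop ℝ≥0} (hτ : IsStoppingTime 𝓕 τ) (t : ℝ≥0) :
    AEStronglyMeasurable (fun ω => M (capped τ t ω) ω) P := by
  obtain ⟨T, hT, hX⟩ := hM.localized
  have hr : ∀ n ω s, ContinuousWithinAt (fun s => stoppedProcess M (T n) s ω) (Set.Ici s) s :=
    fun n => continuousWithinAt_stoppedProcess (fun ω s => (hM.cadlag ω s).1) (T n)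
  refine aestronglyMeasurable_of_tendsto_ae atTop
    (fun n => aestronglyMeasurable_sampled (hX n).1 (hr n) (isStoppingTime_capped hτ t)
      (capped_le τ t)) ?_
  filter_upwards [hT.tendsto_top] with ω hω
  exact tendsto_const_nhds.congr' ((eventually_stoppedProcess_eq hω _).mono fun _ h => h.symm)

lemma enorm_capped_exitTime_le (hc : ∀ ω, IsCadlag fun s => M s ω) {l : ℝ} (hl : 0 ≤ l)
    {t : ℝ≥0} {ω : Ω} (h : exitTime M l ω ≤ t) :
    ‖M (capped (exitTime M l) t ω) ω‖ₑ ≤ ENNReal.ofReal l +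
      ENNReal.ofReal |stoppedValue (jump M) (exitTime M l) ω| +
      ‖{ω | l < |M 0 ω|}.indicator (fun ω => |M 0 ω|) ω‖ₑ := by
  have hind : 0 ≤ {ω | l < |M 0 ω|}.indicator (fun ω => |M 0 ω|) ω :=
    Set.indicator_nonneg (fun _ _ => abs_nonneg _) _
  rw [stoppedValue_exitTime_of_le _ h, ← Real.enorm_abs (M _ ω),
    Real.enorm_of_nonneg (abs_nonneg _), Real.enorm_of_nonneg hind,
    ← ENNReal.ofReal_add hl (abs_nonneg _),
    ← ENNReal.ofReal_add (add_nonneg hl (abs_nonneg _)) hind]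
  exact ENNReal.ofReal_le_ofReal
    (abs_le_of_exitTime_eq (hc ω) hl (coe_capped_of_ge h).symm)

lemma IsLocalMartingale.setLIntegral_capped_le (hM : IsLocalMartingale M 𝓕 P) {l : ℝ} (hl : 0 ≤ l)
    (hτ : IsStoppingTime 𝓕 (exitTime M l)) (t : ℝ≥0) :
    ∫⁻ ω in {ω | exitTime M l ω ≤ t}, ‖M (capped (exitTime M l) t ω) ω‖ₑ ∂P ≤
      ENNReal.ofReal l * P {ω | exitTime M l ω ≤ t} +
      ∫⁻ ω, {ω | exitTime M l ω ≤ t}.indicator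
        (fun ω => ENNReal.ofReal |stoppedValue (jump M) (exitTime M l) ω|) ω ∂P +
      ∫⁻ ω, ‖{ω | l < |M 0 ω|}.indicator (fun ω => |M 0 ω|) ω‖ₑ ∂P := by
  have hms : MeasurableSet {ω | exitTime M l ω ≤ t} := 𝓕.le t _ (hτ.measurableSet_le t)
  have hM0 : Measurable (M 0) := (hM.adapted 0).measurable.mono (𝓕.le 0) le_rfl
  have hm0 : Measurable fun ω => ‖{ω | l < |M 0 ω|}.indicator (fun ω => |M 0 ω|) ω‖ₑ :=
    (hM0.norm.indicator (hM0.norm measurableSet_Ioi)).enorm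
  calc _ ≤ ∫⁻ ω in {ω | exitTime M l ω ≤ t}, (ENNReal.ofReal l +
        ENNReal.ofReal |stoppedValue (jump M) (exitTime M l) ω| +
        ‖{ω | l < |M 0 ω|}.indicator (fun ω => |M 0 ω|) ω‖ₑ) ∂P :=
        setLIntegral_mono' hms fun ω hω => enorm_capped_exitTime_le hM.cadlag hl hω
    _ ≤ _ := by
        rw [lintegral_add_right _ hm0, lintegral_add_left measurable_const, setLIntegral_const,
          lintegral_indicator hms]
        gcongr
        exact Measure.restrict_le_self

lemma IsLocalMartingale.integrable_capped_exitTime [IsProbabilityMeasure P]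
    (hM : IsLocalMartingale M 𝓕 P) {l : ℝ}
    (hl : 0 ≤ l) (hτ : IsStoppingTime 𝓕 (exitTime M l)) {t : ℝ≥0}
    (hj : ∫⁻ ω, {ω | exitTime M l ω ≤ t}.indicator
      (fun ω => ENNReal.ofReal |stoppedValue (jump M) (exitTime M l) ω|) ω ∂P < ∞) :
    Integrable (fun ω => M (capped (exitTime M l) t ω) ω) P := by
  refine ⟨hM.aestronglyMeasurable_capped hτ t, ?_⟩
  have hms : MeasurableSet {ω | exitTime M l ω ≤ t} := 𝓕.le t _ (hτ.measurableSet_le t)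
  have h0 : ∫⁻ ω, ‖{ω | l < |M 0 ω|}.indicator (fun ω => |M 0 ω|) ω‖ₑ ∂P < ∞ := by
    refine (lintegral_mono fun ω => ?_).trans_lt hM.integrable_zero.2
    rw [← Real.enorm_abs (M 0 ω)]
    exact enorm_indicator_le_enorm_self _ _
  rw [HasFiniteIntegral, ← lintegral_add_compl _ hms, ENNReal.add_lt_top]
  constructor
  · refine (hM.setLIntegral_capped_le hl hτ t).trans_lt ?_
    rw [ENNReal.add_lt_top, ENNReal.add_lt_top]
    exact ⟨⟨ENNReal.mul_lt_top ENNReal.ofReal_lt_top (measure_lt_top _ _), hj⟩, h0⟩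
  · refine (setLIntegral_mono' (g := fun _ => ENNReal.ofReal l) hms.compl fun ω hω => ?_).trans_lt ?_
    · have hlt : t < exitTime M l ω := not_le.1 hω
      rw [capped_of_le hlt.le, ← Real.enorm_abs, Real.enorm_of_nonneg (abs_nonneg _)]
      exact ENNReal.ofReal_le_ofReal (abs_le_of_lt_exitTime hlt)
    · rw [setLIntegral_const]
      exact ENNReal.mul_lt_top ENNReal.ofReal_lt_top (measure_lt_top _ _)

/-- Stopped at an exit time with integrable overshoot, a local martingale is a martingale. -/
lemma IsLocalMartingale.setIntegral_capped_exitTime_eq [IsProbabilityMeasure P]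
    (hM : IsLocalMartingale M 𝓕 P) {l : ℝ}
    (hτ : IsStoppingTime 𝓕 (exitTime M l)) {s t : ℝ≥0} (hst : s ≤ t)
    (hint : Integrable (fun ω => M (capped (exitTime M l) t ω) ω) P) {A : Set Ω}
    (hA : MeasurableSet[𝓕 s] A) :
    ∫ ω in A, M (capped (exitTime M l) s ω) ω ∂P =
      ∫ ω in A, M (capped (exitTime M l) t ω) ω ∂P := by
  obtain ⟨T, hT, hX⟩ := hM.localized
  have hr : ∀ n ω s, ContinuousWithinAt (fun s => stoppedProcess M (T n) s ω) (Set.Ici s) s :=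
    fun n => continuousWithinAt_stoppedProcess (fun ω s => (hM.cadlag ω s).1) (T n)
  have key : ∀ u ≤ t, Tendsto
      (fun n => ∫ ω in A, stoppedProcess M (T n) (capped (exitTime M l) u ω) ω ∂P) atTop
      (𝓝 (∫ ω in A, M (capped (exitTime M l) u ω) ω ∂P)) := by
    intro u hu
    refine tendsto_integral_of_dominated_convergence
      (fun ω => |l| + |M (capped (exitTime M l) t ω) ω|)
      (fun n => (aestronglyMeasurable_sampled (hX n).1 (hr n) (isStoppingTime_capped hτ u)
        (capped_le _ u)).restrict) ((integrable_const _).add hint.abs).restrict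
      (fun n => ae_of_all _ fun ω => ?_) (ae_restrict_of_ae ?_)
    -- Stopping by `T n` and by the exit time commute, so the bound uniform in time applies for
    -- every `n`.
    · have e : stoppedProcess M (T n) (capped (exitTime M l) u ω) ω =
          M (capped (exitTime M l) (capped (T n) u ω) ω) ω := by
        rw [stoppedProcess, min_comm]
        change M (capped (T n) (capped (exitTime M l) u ω) ω) ω = _
        congr 1
        rw [← WithTop.coe_inj, coe_capped, coe_capped, coe_capped, coe_capped, min_left_comm]
      rw [e, Real.norm_eq_abs]
      refine (abs_capped_exitTime_le ((capped_le _ u ω).trans hu)).trans (max_le ?_ ?_)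
      · exact (le_abs_self l).trans (le_add_of_nonneg_right (abs_nonneg _))
      · exact le_add_of_nonneg_left (abs_nonneg _)
    · filter_upwards [hT.tendsto_top] with ω hω
      exact tendsto_const_nhds.congr'
        ((eventually_stoppedProcess_eq hω _).mono fun _ h => h.symm)
  refine tendsto_nhds_unique (key s hst) ((key t le_rfl).congr fun n => ?_)
  exact (setIntegral_capped_eq (hX n).1 (hr n) hτ hst hA).symm

/-- The difference vanishes off the exit event; on it, the triangle inequality and the overshoot
bound apply. -/
lemma IsLocalMartingale.lintegral_sub_capped_le (hM : IsLocalMartingale M 𝓕 P) {l : ℝ}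
    (hl : 0 ≤ l) (hτ : IsStoppingTime 𝓕 (exitTime M l)) {t : ℝ≥0} (ht : Integrable (M t) P) :
    ∫⁻ ω, ‖M t ω - M (capped (exitTime M l) t ω) ω‖ₑ ∂P ≤
      ∫⁻ ω in {ω | exitTime M l ω ≤ t}, ‖M t ω‖ₑ ∂P +
      (ENNReal.ofReal l * P {ω | exitTime M l ω ≤ t} +
      ∫⁻ ω, {ω | exitTime M l ω ≤ t}.indicator
        (fun ω => ENNReal.ofReal |stoppedValue (jump M) (exitTime M l) ω|) ω ∂P +
      ∫⁻ ω, ‖{ω | l < |M 0 ω|}.indicator (fun ω => |M 0 ω|) ω‖ₑ ∂P) := by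
  have hms : MeasurableSet {ω | exitTime M l ω ≤ t} := 𝓕.le t _ (hτ.measurableSet_le t)
  rw [← lintegral_add_compl _ hms]
  have h0 : ∫⁻ ω in {ω | exitTime M l ω ≤ t}ᶜ, ‖M t ω - M (capped (exitTime M l) t ω) ω‖ₑ ∂P
      = 0 := by
    rw [← lintegral_zero (μ := P.restrict {ω | exitTime M l ω ≤ t}ᶜ) (α := Ω)]
    refine setLIntegral_congr_fun hms.compl fun ω hω => ?_
    have hlt : t < exitTime M l ω := not_le.1 hω
    simp [capped_of_le hlt.le]
  rw [h0, add_zero]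
  refine le_trans ?_ (add_le_add_right (hM.setLIntegral_capped_le hl hτ t) _)
  rw [← lintegral_add_left' ht.1.restrict.enorm]
  exact lintegral_mono fun ω => enorm_sub_le

lemma IsLocalMartingale.setIntegral_eq [IsProbabilityMeasure P]
    (hM : IsLocalMartingale M 𝓕 P)
    (hτ : ∀ l, IsStoppingTime 𝓕 (exitTime M l)) (hint : ∀ t, Integrable (M t) P)
    (hB : ∀ t : ℝ≥0, Tendsto (fun l : ℝ => ∫⁻ ω, {ω | exitTime M l ω ≤ t}.indicator
      (fun ω => ENNReal.ofReal |stoppedValue (jump M) (exitTime M l) ω|) ω ∂P) atTop (𝓝 0))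
    {s t : ℝ≥0} (hst : s ≤ t)
    (hA : liminf (fun l : ℝ => ENNReal.ofReal l *
      P {ω | ENNReal.ofReal l < runningSup M (t + 1) ω}) atTop = 0)
    {A : Set Ω} (hAs : MeasurableSet[𝓕 s] A) :
    ∫ ω in A, M s ω ∂P = ∫ ω in A, M t ω ∂P := by
  -- A zero liminf gives convergence only along some levels; an ultrafilter finer than `atTop`
  -- selects them and keeps all limits in `l`.
  have hc : MapClusterPt 0 atTop (fun l : ℝ => ENNReal.ofReal l *
      P {ω | ENNReal.ofReal l < runningSup M (t + 1) ω}) := by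
    rw [ENNReal.nhds_zero_basis.mapClusterPt_iff_frequently]
    exact fun ε hε => frequently_lt_of_liminf_lt (by isBoundedDefault) (hA ▸ hε)
  obtain ⟨U, hU, hUt⟩ := mapClusterPt_iff_ultrafilter.1 hc
  have hM0 : Measurable (M 0) := (hM.adapted 0).measurable.mono (𝓕.le 0) le_rfl
  have hP : ∀ u ≤ t, Tendsto (fun l : ℝ => ENNReal.ofReal l * P {ω | exitTime M l ω ≤ u})
      U (𝓝 0) := by
    intro u hu
    refine tendsto_of_tendsto_of_tendsto_of_le_of_le' tendsto_const_nhds hUt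
      (.of_forall fun _ => zero_le) (hU ?_)
    filter_upwards [eventually_ge_atTop 0] with l hl
    gcongr with ω
    intro h
    exact lt_runningSup_of_exitTime_lt hl
      (h.trans_lt (WithTop.coe_lt_coe.2 (hu.trans_lt (lt_add_one t))))
  have hL1 : ∀ u ≤ t, Tendsto
      (fun l => ∫⁻ ω, ‖M (capped (exitTime M l) u ω) ω - M u ω‖ₑ ∂P) U (𝓝 0) := by
    intro u hu
    have hlim := ((tendsto_setLIntegral_exitTime_le hM.cadlag hτ (hint u)
      ((hM.adapted u).measurable.mono (𝓕.le u) le_rfl) u).mono_left hU).add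
      (((hP u hu).add ((hB u).mono_left hU)).add
        ((tendsto_lintegral_indicator_lt_abs hM.integrable_zero hM0).mono_left hU))
    simp only [add_zero] at hlim
    refine tendsto_of_tendsto_of_tendsto_of_le_of_le' tendsto_const_nhds hlim
      (.of_forall fun _ => zero_le) (hU ?_)
    filter_upwards [eventually_ge_atTop 0] with l hl
    simp_rw [enorm_sub_rev _ (M u _)]
    exact hM.lintegral_sub_capped_le hl (hτ l) (hint u)
  have hI : ∀ u, ∀ᶠ l in (U : Filter ℝ),
      Integrable (fun ω => M (capped (exitTime M l) u ω) ω) P := by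
    intro u
    refine hU ?_
    filter_upwards [eventually_ge_atTop 0, (hB u).eventually_lt_const ENNReal.zero_lt_top]
      with l hl hj
    exact hM.integrable_capped_exitTime hl (hτ l) hj
  have key : ∀ u ≤ t, Tendsto (fun l => ∫ ω in A, M (capped (exitTime M l) u ω) ω ∂P) U
      (𝓝 (∫ ω in A, M u ω ∂P)) := fun u hu =>
    tendsto_setIntegral_of_L1 _ (hint u).1 (hI u) (hL1 u hu) A
  refine tendsto_nhds_unique (key s hst) ((key t le_rfl).congr' ?_)
  filter_upwards [hI t] with l hl
  exact (hM.setIntegral_capped_exitTime_eq (hτ l) hst hl hAs).symm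

end LocMart

/-! ### The equivalence -/

theorem corollary2 {Ω : Type*} {mΩ : MeasurableSpace Ω} (P : Measure Ω) [IsProbabilityMeasure P]
    (𝓕 : Filtration ℝ≥0 mΩ) [𝓕.IsRightContinuous]
    (M : ℝ≥0 → Ω → ℝ) (hM : LocMart.IsLocalMartingale M 𝓕 P) :
    Martingale M 𝓕 P ↔
      ∀ t : ℝ≥0,
        liminf (fun l : ℝ =>
          ENNReal.ofReal l * P {ω | ENNReal.ofReal l < LocMart.runningSup M t ω}) atTop = 0 ∧
        Tendsto (fun l : ℝ =>
          ∫⁻ ω, {ω | LocMart.exitTime M l ω ≤ t}.indicator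
            (fun ω => ENNReal.ofReal |stoppedValue (LocMart.jump M) (LocMart.exitTime M l) ω|) ω ∂P)
          atTop (𝓝 0) ∧
        ∫⁻ ω, ENNReal.ofReal |M t ω| ∂P < ∞ := by
  have hτ : ∀ l, IsStoppingTime 𝓕 (LocMart.exitTime M l) :=
    LocMart.isStoppingTime_exitTime hM.adapted fun ω s => (hM.cadlag ω s).1
  have habs : ∀ x : ℝ, ENNReal.ofReal |x| = ‖x‖ₑ := fun x => by
    rw [← Real.enorm_abs, Real.enorm_of_nonneg (abs_nonneg _)]
  constructor
  · intro hmart t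
    have hK := LocMart.tendsto_setLIntegral_exitTime_le hM.cadlag hτ (hmart.integrable t)
      ((hM.adapted t).measurable.mono (𝓕.le t) le_rfl) t
    refine ⟨Tendsto.liminf_eq ?_, ?_, ?_⟩
    · refine tendsto_of_tendsto_of_tendsto_of_le_of_le tendsto_const_nhds hK
        (fun _ => zero_le) fun l => ?_
      refine le_trans ?_ (LocMart.mul_measure_exitTime_le hmart hM.cadlag (hτ l) t)
      gcongr with ω
      exact LocMart.exitTime_le_of_lt_runningSup
    · have h2 := ENNReal.Tendsto.const_mul hK (Or.inr (ENNReal.ofNat_ne_top (n := 2)))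
      rw [mul_zero] at h2
      exact tendsto_of_tendsto_of_tendsto_of_le_of_le tendsto_const_nhds h2
        (fun _ => zero_le)
        fun l => LocMart.lintegral_indicator_jump_le hmart hM.cadlag (hτ l) t
    · simp_rw [habs]
      exact (hmart.integrable t).2
  · intro h
    have hint : ∀ t, Integrable (M t) P := fun t =>
      ⟨((hM.adapted t).mono (𝓕.le t)).aestronglyMeasurable, by
        simpa only [HasFiniteIntegral, habs] using (h t).2.2⟩
    refine ⟨hM.adapted, fun s t hst => (ae_eq_condExp_of_forall_setIntegral_eq (𝓕.le s) (hint t)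
      (fun _ _ _ => (hint s).integrableOn) (fun A hA _ => ?_)
      (hM.adapted s).aestronglyMeasurable).symm⟩
    exact hM.setIntegral_eq hτ hint (fun t => (h t).2.1) hst (h (t + 1)).1 hA
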